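/- Let $\lambda_1>\lambda_2>\lambda_3>\lambda_4\geqslant 0$ with $\sum_{j=1}^4\lambda_j=1$, and let $\Lambda=\mathrm{diag}(\lambda_1,\lambda_2,\lambda_3,\lambda_4)$, a two-qubit state on $\mathbb{C}^2\otimes\mathbb{C}^2$ written in the ordered basis $e_1\otimes e_1,\ e_1\otimes e_2,\ e_2\otimes e_1,\ e_2\otimes e_2$. Let $K=\mathrm{U}(2)\otimes\mathrm{U}(2)$, with Lie algebra $\mathfrak{k}=\mathfrak{u}(2)\otimes\mathbb{1}+\mathbb{1}\otimes\mathfrak{u}(2)$, and let $$\mathcal{O}^{\mathrm{LU}}_\Lambda=\{(U\otimes V)\Lambda(U^{-1}\otimes V^{-1}) : U,V\in\mathrm{U}(2)\}$$ be the local unitary orbit of $\Lambda$. Then the map $\rho\mapsto f_\rho\in\mathfrak{k}^*$, $f_\rho(X)=-\sqrt{-1}\,\mathrm{Tr}(\rho X)$, is injective on $\mathcal{O}^{\mathrm{LU}}_\Lambda$, and so identifies this orbit with the coadjoint orbit of $K$ through $f_\Lambda$. Equip the orbit with the corresponding Kirillov-Kostant-Souriau form $$\omega_\rho([X,\rho],[Y,\rho])=f_\rho([X,Y])=-\sqrt{-1}\,\mathrm{Tr}(\rho[X,Y]),\qquad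 X,Y\in\mathfrak{k}.$$ The symplectic (Liouville) volume of this four-dimensional orbit is $$\mathrm{vol}_{\mathrm{symp}}(\mathcal{O}^{\mathrm{LU}}_\Lambda)=\int_{\mathcal{O}^{\mathrm{LU}}_\Lambda}\frac{\omega^2}{(2\pi)^2\,2!}=(\lambda_1+\lambda_2-\lambda_3-\lambda_4)(\lambda_1+\lambda_3-\lambda_2-\lambda_4).$$ -/

import Mathlib

open scoped Kronecker Matrix ContDiff ENNReal
open MeasureTheory

attribute [local instance] Matrix.normedAddCommGroup Matrix.normedSpace

noncomputable section

/-! ### Liouville volume of an embedded submanifold carrying a 2-form -/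

/-- `φ`, restricted to the open set `U ⊆ ℝᵈ`, is a smooth local parametrization of the
`d`-dimensional embedded submanifold `S` of `V`: a smooth immersion which is a homeomorphism of `U`
onto a relatively open subset of `S`. -/
structure IsLocalParametrization {V : Type*} [NormedAddCommGroup V] [NormedSpace ℝ V] {d : ℕ}
    (S : Set V) (U : Set (Fin d → ℝ)) (φ : (Fin d → ℝ) → V) : Prop where
  isOpen_domain : IsOpen U
  contDiffOn : ContDiffOn ℝ ∞ φ U
  injective_fderiv : ∀ x ∈ U, Function.Injective (fderiv ℝ φ x)
  isEmbedding : Topology.IsEmbedding (U.domRestrict φ)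
  isOpen_image : ∃ W : Set V, IsOpen W ∧ φ '' U = S ∩ W

/-- The Pfaffian `(1 / (2ⁿ n!)) ∑_σ sgn σ ∏_{i < n} M (σ (2i)) (σ (2i+1))`.  If
`M i j = Ω (∂ᵢ, ∂ⱼ)` is the matrix of a 2-form `Ω` in coordinates `x₁, …, x₂ₙ`, then
`Ωⁿ / n! = pfaffian M · dx₁ ∧ ⋯ ∧ dx₂ₙ`. -/
def pfaffian (n : ℕ) (M : Matrix (Fin (2 * n)) (Fin (2 * n)) ℝ) : ℝ :=
  ((2 : ℝ) ^ n * (n.factorial : ℝ))⁻¹ *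
    ∑ σ : Equiv.Perm (Fin (2 * n)), ((Equiv.Perm.sign σ : ℤ) : ℝ) *
      ∏ i : Fin n, M (σ ⟨2 * i.val, by omega⟩) (σ ⟨2 * i.val + 1, by omega⟩)

/-- Density, in the parametrization `φ`, of the volume form `Ωⁿ / ((2π)ⁿ n!)`. A 2-form `Ω` is given
by its values `Ω ρ v w` at points `ρ` and tangent vectors `v`, `w`. -/
def liouvilleDensity {V : Type*} [NormedAddCommGroup V] [NormedSpace ℝ V] (n : ℕ)
    (Ω : V → V → V → ℝ) (φ : (Fin (2 * n) → ℝ) → V) (x : Fin (2 * n) → ℝ) : ℝ :=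
  |pfaffian n fun i j =>
      Ω (φ x) (fderiv ℝ φ x (Pi.single i 1)) (fderiv ℝ φ x (Pi.single j 1))| /
    (2 * Real.pi) ^ n

/-- The Liouville measure `|Ωⁿ| / ((2π)ⁿ n!)` of a `2n`-dimensional submanifold `S` with 2-form `Ω`.
On the image of a local parametrization it is the push-forward of the density above; these measures
agree on overlaps, so the measure which they glue to is their supremum (the least measure
dominating each of them). -/
def liouvilleMeasure {V : Type*} [NormedAddCommGroup V] [NormedSpace ℝ V] [MeasurableSpace V]
    (n : ℕ) (S : Set V) (Ω : V → V → V → ℝ) : Measure V :=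
  ⨆ (U : Set (Fin (2 * n) → ℝ)) (φ : (Fin (2 * n) → ℝ) → V) (_ : IsLocalParametrization S U φ),
    Measure.map φ ((volume.restrict U).withDensity
      fun x => ENNReal.ofReal (liouvilleDensity n Ω φ x))

/-- The symplectic volume `∫_S Ωⁿ / ((2π)ⁿ n!)`. -/
def symplecticVolume {V : Type*} [NormedAddCommGroup V] [NormedSpace ℝ V] [MeasurableSpace V]
    (n : ℕ) (S : Set V) (Ω : V → V → V → ℝ) : ℝ≥0∞ :=
  liouvilleMeasure n S Ω S

/-! ### Local unitary orbits of two-qubit states -/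

/-- Complex matrices acting on `ℂ² ⊗ ℂ²`; the basis vector `e_i ⊗ e_j` has index `(i, j)`. -/
abbrev TwoQubitMatrix : Type := Matrix (Fin 2 × Fin 2) (Fin 2 × Fin 2) ℂ

instance : MeasurableSpace TwoQubitMatrix := borel TwoQubitMatrix

instance : BorelSpace TwoQubitMatrix := ⟨rfl⟩

/-- The diagonal matrix `diag (l₁, l₂, l₃, l₄)` with respect to the ordered basis
`e₀ ⊗ e₀, e₀ ⊗ e₁, e₁ ⊗ e₀, e₁ ⊗ e₁`. -/
def diagonalState (l₁ l₂ l₃ l₄ : ℝ) : TwoQubitMatrix :=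
  Matrix.diagonal fun p => ((!![l₁, l₂; l₃, l₄] p.1 p.2 : ℝ) : ℂ)

/-- The orbit of `Λ` under conjugation by `U(2) ⊗ U(2)`. -/
def localUnitaryOrbit (Λ : TwoQubitMatrix) : Set TwoQubitMatrix :=
  {ρ | ∃ U ∈ Matrix.unitaryGroup (Fin 2) ℂ, ∃ V ∈ Matrix.unitaryGroup (Fin 2) ℂ,
    ρ = (U ⊗ₖ V) * Λ * (U⁻¹ ⊗ₖ V⁻¹)}

/-- The Lie algebra `𝔨 = 𝔲(2) ⊗ 1 + 1 ⊗ 𝔲(2)` of `K = U(2) ⊗ U(2)`, where `𝔲(2)` consists of the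
skew-Hermitian matrices. -/
def localUnitaryLieAlgebra : Set TwoQubitMatrix :=
  {X | ∃ A B : Matrix (Fin 2) (Fin 2) ℂ, Aᴴ = -A ∧ Bᴴ = -B ∧ X = A ⊗ₖ 1 + 1 ⊗ₖ B}

/-- The pairing `-i tr (ρ X)` induced by the Hilbert-Schmidt inner product; it is real when `ρ` is
Hermitian and `X` is skew-Hermitian. -/
def hsPairing (ρ X : TwoQubitMatrix) : ℝ := (-Complex.I * (ρ * X).trace).re

/-- The element `X ↦ -i tr (ρ X)` of `𝔨*` that corresponds to a Hermitian matrix `ρ`. For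
`ρ ∈ i𝔨` this is the identification of `i𝔨` with `𝔨*` through the Hilbert-Schmidt inner product. -/
def coadjointPoint (ρ : TwoQubitMatrix) : localUnitaryLieAlgebra → ℝ := fun X => hsPairing ρ X

open Classical in
/-- The Kirillov-Kostant-Souriau form
`ω_ρ ([X, ρ], [Y, ρ]) = -i tr (ρ [X, Y])`, for `X, Y ∈ 𝔨`. Here `[X, ρ]` is the velocity at `ρ` of
the action of `X` by conjugation, so the pairs of these vectors are the pairs of tangent vectors at
`ρ` to the orbit of `ρ`. The value does not depend on the choice of `X` and `Y`
(see `kksForm_apply`); off the tangent spaces it is set to zero. -/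
def kksForm (ρ v w : TwoQubitMatrix) : ℝ :=
  if h : ∃ p : localUnitaryLieAlgebra × localUnitaryLieAlgebra,
      v = ⁅(p.1 : TwoQubitMatrix), ρ⁆ ∧ w = ⁅(p.2 : TwoQubitMatrix), ρ⁆ then
    hsPairing ρ ⁅(h.choose.1 : TwoQubitMatrix), (h.choose.2 : TwoQubitMatrix)⁆
  else 0

lemma trace_mul_lie_eq (ρ X Y : TwoQubitMatrix) :
    (ρ * ⁅X, Y⁆).trace = -(⁅X, ρ⁆ * Y).trace := by
  simp only [Ring.lie_def, mul_sub, sub_mul, Matrix.trace_sub]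
  rw [← mul_assoc, ← mul_assoc, Matrix.trace_mul_comm (ρ * Y) X, ← mul_assoc]
  ring

lemma kksForm_apply (ρ : TwoQubitMatrix) {X Y : TwoQubitMatrix}
    (hX : X ∈ localUnitaryLieAlgebra) (hY : Y ∈ localUnitaryLieAlgebra) :
    kksForm ρ ⁅X, ρ⁆ ⁅Y, ρ⁆ = hsPairing ρ ⁅X, Y⁆ := by
  have h : ∃ p : localUnitaryLieAlgebra × localUnitaryLieAlgebra,
      ⁅X, ρ⁆ = ⁅(p.1 : TwoQubitMatrix), ρ⁆ ∧ ⁅Y, ρ⁆ = ⁅(p.2 : TwoQubitMatrix), ρ⁆ :=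
    ⟨(⟨X, hX⟩, ⟨Y, hY⟩), rfl, rfl⟩
  have h1 := h.choose_spec.1
  have h2 := h.choose_spec.2
  rw [kksForm, dif_pos h]
  generalize (h.choose.1 : TwoQubitMatrix) = X' at h1 ⊢
  generalize (h.choose.2 : TwoQubitMatrix) = Y' at h2 ⊢
  unfold hsPairing
  have sk : ∀ A B : TwoQubitMatrix, -⁅B, A⁆ = ⁅A, B⁆ := fun A B => by
    rw [Ring.lie_def, Ring.lie_def, neg_sub]
  have key : (ρ * ⁅X', Y'⁆).trace = (ρ * ⁅X, Y⁆).trace := by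
    rw [trace_mul_lie_eq, ← h1, ← trace_mul_lie_eq, ← sk X Y', ← sk X Y, mul_neg,
      mul_neg, Matrix.trace_neg, Matrix.trace_neg, trace_mul_lie_eq, ← h2, ← trace_mul_lie_eq]
  rw [key]

end

/-! ### Liouville measures in charts -/

/-! A state in the orbit has the form `(1 + a n·σ ⊗ 1 + b 1 ⊗ m·σ + c n·σ ⊗ m·σ) / 4`, with `a = l₁
+ l₂ - l₃ - l₄` and `b = l₁ + l₃ - l₂ - l₄`. Local unitaries rotate the unit vectors `n` and `m`
independently, so the orbit is parametrized by S² × S² (`localUnitaryOrbit_correlatedState`).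
Elements of `𝔨` see only the two marginals, because `n·σ` and `m·σ` are traceless and the `c`-term
drops out of the trace. Hence the functional of `ρ` determines `a n` and `b m`, and since `a, b > 0`
it determines `ρ`: this is the injectivity. For the same reason the symplectic form is `-(a/2) σ₁ -
(b/2) σ₂`, with `σ₁`, `σ₂` the area forms of the two spheres (`kksForm_correlatedVelocity`). So
`|ω²/2|` is `ab/4` times the product area, and the volume is `(ab/4)(4π)² / (2π)² = ab`.

The Liouville measure is a supremum over all local parametrizations, so one of them must be shown to
dominate the rest. A product of two stereographic charts does. On its domain, domination is the
change of variables formula (`chartMeasure_inter_le`); the part of the orbit that it misses is null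
for every parametrization, as the three other products of stereographic charts show
(`chartMeasure_le`). In this chart the density is `ab` times a product of two Fubini-Study
densities, each of mass one (`lintegral_fubiniStudy`). -/

open Equiv.Perm in
lemma sum_perm_fin_four (f : Equiv.Perm (Fin 4) → ℝ) :
    ∑ σ, f σ = ∑ i : Fin 4, ∑ j : Fin 3, ∑ k : Fin 2,
      f (decomposeFin.symm (i, decomposeFin.symm (j, decomposeFin.symm (k, 1)))) := by
  rw [← decomposeFin.symm.sum_comp, Fintype.sum_prod_type]
  refine Finset.sum_congr rfl fun i _ => ?_
  rw [← decomposeFin.symm.sum_comp, Fintype.sum_prod_type]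
  refine Finset.sum_congr rfl fun j _ => ?_
  rw [← decomposeFin.symm.sum_comp, Fintype.sum_prod_type]
  refine Finset.sum_congr rfl fun k _ => ?_
  rw [Fintype.sum_eq_single 1 (fun b hb => (hb (Subsingleton.elim _ _)).elim)]

-- Each of the three perfect matchings of four indices arises from 8 = 2² · 2! permutations, all
-- contributing the same term by antisymmetry; this cancels the normalization.
open Equiv.Perm in
lemma pfaffian_two (M : Matrix (Fin (2 * 2)) (Fin (2 * 2)) ℝ) (hM : ∀ i j, M j i = -M i j) :
    pfaffian 2 M = M 0 1 * M 2 3 - M 0 2 * M 1 3 + M 0 3 * M 1 2 := by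
  have hs : ∀ (i : Fin 4) (j : Fin 3) (k : Fin 2),
      sign (decomposeFin.symm (i, decomposeFin.symm (j, decomposeFin.symm (k, 1)))) =
        (if i = 0 then 1 else -1) * ((if j = 0 then 1 else -1) * if k = 0 then 1 else -1) := by
    intro i j k
    simp only [decomposeFin.symm_sign, Equiv.Perm.sign_one, mul_one]
  have hv : ∀ (i : Fin 4) (j : Fin 3) (k : Fin 2) (x : Fin 4),
      decomposeFin.symm (i, decomposeFin.symm (j, decomposeFin.symm (k, 1))) x =
        ![i, Equiv.swap 0 i j.succ, Equiv.swap 0 i (Equiv.swap 0 j k.succ).succ,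
          Equiv.swap 0 i (Equiv.swap 0 j (Equiv.swap 0 k 1).succ).succ] x := by decide
  change Matrix (Fin 4) (Fin 4) ℝ at M
  have h : pfaffian 2 M = 8⁻¹ * ∑ σ : Equiv.Perm (Fin 4), ((sign σ : ℤ) : ℝ) *
      (M (σ 0) (σ 1) * M (σ 2) (σ 3)) := by
    unfold pfaffian
    simp only [Fin.prod_univ_two]
    norm_num [Nat.factorial]
    rfl
  rw [h, sum_perm_fin_four]
  simp only [hs, hv, Fin.sum_univ_succ]
  simp [Equiv.swap_apply_def]
  rw [hM 0 1, hM 0 2, hM 0 3, hM 1 2, hM 1 3, hM 2 3]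
  ring

/-- `M` is the matrix of the pull-back under `J` of `α dx₀ ∧ dx₁ + β dx₂ ∧ dx₃`. Half the square of
that form is `αβ` times the volume form, which pulls back by `det J`. -/
lemma pfaffian_two_congr (M J : Matrix (Fin (2 * 2)) (Fin (2 * 2)) ℝ) (α β : ℝ)
    (hM : ∀ i j, M i j = α * (J 0 i * J 1 j - J 1 i * J 0 j)
      + β * (J 2 i * J 3 j - J 3 i * J 2 j)) :
    pfaffian 2 M = J.det * (α * β) := by
  rw [pfaffian_two M (fun i j => by rw [hM, hM]; ring)]
  simp only [hM]
  change Matrix (Fin 4) (Fin 4) ℝ at J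
  change _ = Matrix.det (n := Fin 4) J * _
  rw [Matrix.det_succ_row_zero]
  simp [Fin.sum_univ_succ, Fin.succAbove, Matrix.det_fin_three]
  ring

/-! ### The mass of the Fubini-Study density, and products of integrals on ℝ⁴ -/

lemma lintegral_Ioi_div_one_add_sq_sq :
    ∫⁻ r in Set.Ioi (0 : ℝ), ENNReal.ofReal (2 * r / (1 + r ^ 2) ^ 2) = 1 := by
  have hd : ∀ r : ℝ, HasDerivAt (fun r : ℝ => -(1 + r ^ 2)⁻¹) (2 * r / (1 + r ^ 2) ^ 2) r := by
    intro r
    have h0 : 1 + r ^ 2 ≠ 0 := by positivity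
    refine (((hasDerivAt_pow 2 r).const_add 1).fun_inv h0).fun_neg.congr_deriv ?_
    simp [neg_div]
  have hc : ContinuousWithinAt (fun r : ℝ => -(1 + r ^ 2)⁻¹) (Set.Ici 0) 0 :=
    (hd 0).continuousAt.continuousWithinAt
  have hn : ∀ r ∈ Set.Ioi (0 : ℝ), 0 ≤ 2 * r / (1 + r ^ 2) ^ 2 := fun r hr => by
    have : (0 : ℝ) < r := hr
    positivity
  have ht : Filter.Tendsto (fun r : ℝ => -(1 + r ^ 2)⁻¹) Filter.atTop (nhds 0) := by
    rw [← neg_zero]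
    exact (tendsto_inv_atTop_zero.comp (Filter.tendsto_atTop_add_const_left _ 1
      (Filter.tendsto_pow_atTop two_ne_zero))).neg
  rw [← ofReal_integral_eq_lintegral_ofReal
    (integrableOn_Ioi_deriv_of_nonneg hc (fun r _ => hd r) hn ht)
    (ae_restrict_of_forall_mem measurableSet_Ioi hn),
    integral_Ioi_of_hasDerivAt_of_nonneg hc (fun r _ => hd r) hn ht]
  simp

/-- The Fubini-Study density of the plane has total mass one. -/
lemma lintegral_fubiniStudy :
    ∫⁻ p : ℝ × ℝ, ENNReal.ofReal (1 / (Real.pi * (1 + p.1 ^ 2 + p.2 ^ 2) ^ 2)) = 1 := by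
  have hpi := Real.pi_pos
  rw [← lintegral_comp_polarCoord_symm]
  -- The constants are split so that the radial factor has mass one and the angular factor is
  -- uniform on an interval of length 2π.
  have h : ∀ p ∈ polarCoord.target, ENNReal.ofReal p.1 • ENNReal.ofReal
      (1 / (Real.pi * (1 + (polarCoord.symm p).1 ^ 2 + (polarCoord.symm p).2 ^ 2) ^ 2)) =
      ENNReal.ofReal (2 * p.1 / (1 + p.1 ^ 2) ^ 2) * ENNReal.ofReal (1 / (2 * Real.pi)) := by
    intro p hp
    have hp1 : 0 < p.1 := hp.1
    rw [smul_eq_mul, ← ENNReal.ofReal_mul hp1.le, ← ENNReal.ofReal_mul (by positivity)]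
    congr 1
    have : 1 + (polarCoord.symm p).1 ^ 2 + (polarCoord.symm p).2 ^ 2 = 1 + p.1 ^ 2 := by
      simp only [polarCoord_symm_apply]
      linear_combination p.1 ^ 2 * Real.sin_sq_add_cos_sq p.2
    rw [this]
    field_simp
  rw [setLIntegral_congr_fun polarCoord.open_target.measurableSet h, polarCoord_target,
    Measure.volume_eq_prod, ← Measure.prod_restrict,
    lintegral_prod_mul (f := fun r : ℝ => ENNReal.ofReal (2 * r / (1 + r ^ 2) ^ 2))
      (g := fun _ : ℝ => ENNReal.ofReal (1 / (2 * Real.pi))) (by fun_prop) (by fun_prop),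
    lintegral_Ioi_div_one_add_sq_sq, setLIntegral_const, Real.volume_Ioo, one_mul,
    ← ENNReal.ofReal_mul (by positivity), ← ENNReal.ofReal_one]
  congr 1
  field_simp
  ring

lemma lintegral_fin_four_mul (f g : ℝ × ℝ → ℝ≥0∞) (hf : Measurable f) (hg : Measurable g) :
    ∫⁻ v : Fin (2 * 2) → ℝ, f (v 0, v 1) * g (v 2, v 3) =
      (∫⁻ p, f p) * ∫⁻ p, g p := by
  have e1 := volume_preserving_piFinTwo (fun _ => ℝ)
  have h1 := (volume_measurePreserving_piCongrLeft (fun _ : Fin (2 * 2) => ℝ)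
    (finSumFinEquiv : Fin 2 ⊕ Fin 2 ≃ Fin (2 + 2))).symm
  have h2 := volume_measurePreserving_sumPiEquivProdPi (fun _ : Fin 2 ⊕ Fin 2 => ℝ)
  have h := (e1.prod e1).comp (h2.comp h1)
  rw [← lintegral_prod_mul hf.aemeasurable hg.aemeasurable,
    ← MeasurePreserving.lintegral_comp h (f := fun z => f z.1 * g z.2) (by fun_prop)]
  rfl

/-! ### Chart measures and their comparison under change of coordinates -/

noncomputable section

/-- The push-forward under `φ` of the Liouville density on `U`. -/
def chartMeasure {V : Type*} [NormedAddCommGroup V] [NormedSpace ℝ V] [MeasurableSpace V]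
    (n : ℕ) (Ω : V → V → V → ℝ) (U : Set (Fin (2 * n) → ℝ)) (φ : (Fin (2 * n) → ℝ) → V) :
    Measure V :=
  Measure.map φ ((volume.restrict U).withDensity
    fun x => ENNReal.ofReal (liouvilleDensity n Ω φ x))

variable {V : Type*} [NormedAddCommGroup V] [NormedSpace ℝ V]

/-- The value at `u`, `w` of the pull-back of the 2-form `Ω` under `φ`, at the point `x`. -/
def pullbackForm {n : ℕ} (Ω : V → V → V → ℝ) (φ : (Fin n → ℝ) → V) (x u w : Fin n → ℝ) : ℝ :=
  Ω (φ x) (fderiv ℝ φ x u) (fderiv ℝ φ x w)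

/-- `Ω` is an arbitrary function, with no linearity available, so its arguments have to be
identified exactly; derivatives along lines do this. -/
lemma pullbackForm_eq {n : ℕ} (Ω : V → V → V → ℝ) {φ : (Fin n → ℝ) → V} {x u w : Fin n → ℝ}
    {u' w' : V} (hφ : DifferentiableAt ℝ φ x)
    (hu : HasDerivAt (fun t : ℝ => φ (x + t • u)) u' 0)
    (hw : HasDerivAt (fun t : ℝ => φ (x + t • w)) w' 0) :
    pullbackForm Ω φ x u w = Ω (φ x) u' w' := by
  rw [pullbackForm, ← hφ.lineDeriv_eq_fderiv, ← hφ.lineDeriv_eq_fderiv]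
  exact congrArg₂ _ hu.deriv hw.deriv

lemma liouvilleDensity_eq {n : ℕ} (Ω : V → V → V → ℝ) (φ : (Fin (2 * n) → ℝ) → V)
    (x : Fin (2 * n) → ℝ) :
    liouvilleDensity n Ω φ x =
      |pfaffian n fun i j => pullbackForm Ω φ x (Pi.single i 1) (Pi.single j 1)| /
        (2 * Real.pi) ^ n :=
  rfl

/-- A smooth map with a differentiable left inverse on an open set is a local parametrization. -/
lemma isLocalParametrization_of_leftInverse {d : ℕ} {S W : Set V} {φ : (Fin d → ℝ) → V}
    {π₀ : V → Fin d → ℝ} (hW : IsOpen W) (hφ : ContDiff ℝ ∞ φ) (hπ₀ : DifferentiableOn ℝ π₀ W)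
    (hmem : ∀ x, φ x ∈ S ∩ W) (hl : ∀ x, π₀ (φ x) = x) (hr : ∀ ρ ∈ S ∩ W, φ (π₀ ρ) = ρ) :
    IsLocalParametrization S Set.univ φ where
  isOpen_domain := isOpen_univ
  contDiffOn := hφ.contDiffOn
  injective_fderiv x _ := by
    have h1 := (hπ₀.differentiableAt (hW.mem_nhds (hmem x).2)).hasFDerivAt.comp x
      (hφ.differentiable (by simp) x).hasFDerivAt
    rw [show π₀ ∘ φ = id from funext hl] at h1
    have h2 := h1.unique (hasFDerivAt_id x)
    exact Function.LeftInverse.injective fun u => DFunLike.congr_fun h2 u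
  isEmbedding := by
    have h1 : Topology.IsEmbedding (fun x => (⟨φ x, (hmem x).2⟩ : W)) :=
      Function.LeftInverse.isEmbedding (f := W.domRestrict π₀) hl hπ₀.continuousOn.domRestrict
        (hφ.continuous.subtype_mk _)
    exact (Topology.IsEmbedding.subtypeVal.comp h1).comp Topology.IsEmbedding.subtypeVal
  isOpen_image := by
    refine ⟨W, hW, Set.Subset.antisymm ?_ fun ρ hρ => ⟨π₀ ρ, trivial, hr ρ hρ⟩⟩
    rintro _ ⟨x, -, rfl⟩
    exact hmem x

variable [MeasurableSpace V] [BorelSpace V]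

lemma chartMeasure_apply {n : ℕ} (Ω : V → V → V → ℝ) {U : Set (Fin (2 * n) → ℝ)}
    {φ : (Fin (2 * n) → ℝ) → V} (hU : MeasurableSet U) (hφ : ContinuousOn φ U) {A : Set V}
    (hA : MeasurableSet A) :
    chartMeasure n Ω U φ A =
      ∫⁻ x in φ ⁻¹' A ∩ U, ENNReal.ofReal (liouvilleDensity n Ω φ x) := by
  rw [chartMeasure, Measure.map_apply_of_aemeasurable _ hA, withDensity_apply',
    Measure.restrict_restrict' hU]
  exact (hφ.aemeasurable hU).mono_ac (withDensity_absolutelyContinuous _ _)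

/-- Let `φ₀` be a differentiable chart with differentiable left inverse `π₀` on an open set `W`, for
which the Pfaffian of the pull-back of `Ω` transforms by determinants. On `W`, the measures given by
all other parametrizations are dominated by the one given by `φ₀`. -/
lemma chartMeasure_inter_le {n : ℕ} {S W : Set V} {U : Set (Fin (2 * n) → ℝ)}
    {φ φ₀ : (Fin (2 * n) → ℝ) → V} {π₀ : V → Fin (2 * n) → ℝ} {Ω : V → V → V → ℝ}
    (hφ : IsLocalParametrization S U φ) (hW : IsOpen W) (hφ₀ : Differentiable ℝ φ₀)
    (hπ₀ : DifferentiableOn ℝ π₀ W) (hinv : ∀ ρ ∈ S ∩ W, φ₀ (π₀ ρ) = ρ)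
    (hΩ : ∀ y (J : (Fin (2 * n) → ℝ) →L[ℝ] (Fin (2 * n) → ℝ)),
      pfaffian n (fun i j => pullbackForm Ω φ₀ y (J (Pi.single i 1)) (J (Pi.single j 1))) =
        J.det * pfaffian n (fun i j => pullbackForm Ω φ₀ y (Pi.single i 1) (Pi.single j 1)))
    {A : Set V} (hA : MeasurableSet A) :
    chartMeasure n Ω U φ (A ∩ W) ≤ chartMeasure n Ω Set.univ φ₀ A := by
  have hcont : ContinuousOn φ U := hφ.contDiffOn.continuousOn
  have hUm := hφ.isOpen_domain.measurableSet
  have hS : ∀ x ∈ U, φ x ∈ S := by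
    obtain ⟨W', -, h⟩ := hφ.isOpen_image
    intro x hx
    exact (h ▸ Set.mem_image_of_mem φ hx : φ x ∈ S ∩ W').1
  have hinj : Set.InjOn φ U := Set.injOn_iff_injective.2 hφ.isEmbedding.injective
  rw [chartMeasure_apply Ω hUm hcont (hA.inter hW.measurableSet),
    chartMeasure_apply Ω MeasurableSet.univ hφ₀.continuous.continuousOn hA]
  set T : Set (Fin (2 * n) → ℝ) := φ ⁻¹' (A ∩ W) ∩ U with hT
  -- `φ` is continuous only on `U`, so measurability is checked in the subtype `U` and carried over
  -- by the inclusion.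
  have hTm : MeasurableSet T := by
    have h1 : Measurable (U.domRestrict φ) := hcont.domRestrict.measurable
    have h2 := hUm.subtype_image (h1 (hA.inter hW.measurableSet))
    convert h2 using 1
    ext x
    simp [hT, Set.domRestrict, and_comm]
    tauto
  have hopen : IsOpen (U ∩ φ ⁻¹' W) := hcont.isOpen_inter_preimage hφ.isOpen_domain hW
  have hd : ∀ x ∈ T, DifferentiableAt ℝ φ x := fun x hx =>
    (hφ.contDiffOn.differentiableOn (by simp)).differentiableAt
      (hφ.isOpen_domain.mem_nhds hx.2)
  have hψ : ∀ x ∈ T, DifferentiableAt ℝ (π₀ ∘ φ) x := fun x hx =>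
    ((hπ₀.differentiableAt (hW.mem_nhds hx.1.2))).comp x (hd x hx)
  have hloc : ∀ x ∈ U ∩ φ ⁻¹' W, φ₀ ((π₀ ∘ φ) x) = φ x := fun x hx =>
    hinv _ ⟨hS x hx.1, hx.2⟩
  -- Near `x` the map `φ` factors through `φ₀` by the transition map `π₀ ∘ φ`, whose derivative will
  -- play the role of `J` in `hΩ`.
  have hfd : ∀ x ∈ T, fderiv ℝ φ x =
      (fderiv ℝ φ₀ ((π₀ ∘ φ) x)).comp (fderiv ℝ (π₀ ∘ φ) x) := by
    intro x hx
    rw [← fderiv_comp x (hφ₀ _) (hψ x hx)]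
    refine Filter.EventuallyEq.fderiv_eq ?_
    filter_upwards [hopen.mem_nhds ⟨hx.2, hx.1.2⟩] with z hz
    exact (hloc z hz).symm
  calc ∫⁻ x in T, ENNReal.ofReal (liouvilleDensity n Ω φ x)
      = ∫⁻ x in T, ENNReal.ofReal |(fderiv ℝ (π₀ ∘ φ) x).det| *
          ENNReal.ofReal (liouvilleDensity n Ω φ₀ ((π₀ ∘ φ) x)) := by
        refine setLIntegral_congr_fun hTm fun x hx => ?_
        rw [← ENNReal.ofReal_mul (abs_nonneg _)]
        congr 1
        rw [liouvilleDensity_eq, liouvilleDensity_eq, ← mul_div_assoc, ← abs_mul, ← hΩ]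
        simp only [pullbackForm, hfd x hx, hloc x ⟨hx.2, hx.1.2⟩]
        rfl
    _ = ∫⁻ y in (π₀ ∘ φ) '' T, ENNReal.ofReal (liouvilleDensity n Ω φ₀ y) := by
        refine (lintegral_image_eq_lintegral_abs_det_fderiv_mul volume hTm
          (fun x hx => (hψ x hx).hasFDerivAt.hasFDerivWithinAt) ?_
          (fun y => ENNReal.ofReal (liouvilleDensity n Ω φ₀ y))).symm
        -- The transition map is injective on `T` because `φ` is, and `φ` is recovered from it by
        -- applying `φ₀`.
        intro x hx y hy hxy
        refine hinj hx.2 hy.2 ?_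
        rw [← hloc x ⟨hx.2, hx.1.2⟩, ← hloc y ⟨hy.2, hy.1.2⟩, hxy]
    _ ≤ _ := by
        refine lintegral_mono_set ?_
        rintro _ ⟨x, hx, rfl⟩
        refine ⟨?_, trivial⟩
        rw [Set.mem_preimage, hloc x ⟨hx.2, hx.1.2⟩]
        exact hx.1.1
end

noncomputable section

/-! ### Bloch vectors -/

/-- The matrix `n · σ`, where `σ` is the vector of Pauli matrices. -/
def bloch (n : Fin 3 → ℝ) : Matrix (Fin 2) (Fin 2) ℂ :=
  !![(n 2 : ℂ), n 0 - n 1 * Complex.I; n 0 + n 1 * Complex.I, -n 2]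

/-- The unit sphere in `ℝ³`. -/
def blochSphere : Set (Fin 3 → ℝ) := {n | n 0 ^ 2 + n 1 ^ 2 + n 2 ^ 2 = 1}

/-- The matrix `(1 + a P ⊗ 1 + b 1 ⊗ Q + c P ⊗ Q) / 4`. -/
def correlatedState (a b c : ℝ) (P Q : Matrix (Fin 2) (Fin 2) ℂ) : TwoQubitMatrix :=
  (1 / 4 : ℂ) • (1 + (a : ℂ) • P ⊗ₖ 1 + (b : ℂ) • 1 ⊗ₖ Q + (c : ℂ) • P ⊗ₖ Q)

lemma bloch_conjTranspose (n : Fin 3 → ℝ) : (bloch n)ᴴ = bloch n := by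
  ext i j
  fin_cases i <;> fin_cases j <;> (simp [bloch, Matrix.conjTranspose_apply]; try ring)

lemma bloch_mul_bloch_add (n u : Fin 3 → ℝ) :
    bloch n * bloch u + bloch u * bloch n =
      ((2 * (n 0 * u 0 + n 1 * u 1 + n 2 * u 2) : ℝ) : ℂ) • (1 : Matrix (Fin 2) (Fin 2) ℂ) := by
  ext i j
  fin_cases i <;> fin_cases j <;> simp [bloch] <;> ring_nf <;>
    simp only [Complex.I_sq] <;> ring

lemma bloch_mul_self {n : Fin 3 → ℝ} (hn : n ∈ blochSphere) : bloch n * bloch n = 1 := by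
  have hn' : (n 0 : ℂ) ^ 2 + (n 1 : ℂ) ^ 2 + (n 2 : ℂ) ^ 2 = 1 := by exact_mod_cast hn
  ext i j
  fin_cases i <;> fin_cases j <;> simp [bloch] <;>
    first | linear_combination hn' - (n 1 : ℂ) ^ 2 * Complex.I_sq | ring

/-- Every Hermitian traceless involution is `n · σ` for a unit vector `n`. -/
lemma exists_bloch_eq {P : Matrix (Fin 2) (Fin 2) ℂ} (h : Pᴴ = P) (ht : P.trace = 0)
    (h1 : P * P = 1) : ∃ n ∈ blochSphere, P = bloch n := by
  -- Hermitian symmetry makes the diagonal real and the off-diagonal entries conjugate; the (0, 0)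
  -- entry of `P * P = 1` is then the unit length of the vector.
  have h00 := congrFun (congrFun h 0) 0
  have h11 := congrFun (congrFun h 0) 1
  have hm := congrFun (congrFun h1 0) 0
  simp only [Matrix.conjTranspose_apply, Matrix.trace_fin_two, Matrix.mul_apply,
    Fin.sum_univ_two, Complex.ext_iff, Complex.star_def, Complex.conj_re, Complex.conj_im,
    Complex.add_re, Complex.add_im, Complex.mul_re, Complex.mul_im, Matrix.one_apply_eq,
    Complex.zero_re, Complex.zero_im, Complex.one_re, Complex.one_im] at h00 h11 ht hm
  refine ⟨![(P 1 0).re, (P 1 0).im, (P 0 0).re], ?_, ?_⟩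
  · simp only [blochSphere, Set.mem_ofPred_eq, Matrix.cons_val]
    have e : (P 0 0).im = 0 := by linarith [h00.2]
    rw [← h11.1, ← h11.2, e] at hm
    linarith [hm.1]
  · ext i j
    fin_cases i <;> fin_cases j <;> simp [bloch, Complex.ext_iff] <;>
      first | linarith [h00.2] | constructor <;> linarith [h00.2, h11.1, h11.2, ht.1, ht.2]

/-- Every unit vector is the image of the north pole under a special unitary matrix. -/
lemma exists_unitary_conj_eq_bloch {n : Fin 3 → ℝ} (hn : n ∈ blochSphere) :
    ∃ U ∈ Matrix.unitaryGroup (Fin 2) ℂ, U * bloch ![0, 0, 1] * U⁻¹ = bloch n := by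
  have key : ∀ U ∈ Matrix.unitaryGroup (Fin 2) ℂ, U * bloch ![0, 0, 1] = bloch n * U →
      U * bloch ![0, 0, 1] * U⁻¹ = bloch n := fun U hU h => by
    rw [h, mul_assoc, Matrix.mul_nonsing_inv _
      (Matrix.UnitaryGroup.det_isUnit ⟨U, hU⟩), mul_one]
  have hn' : n 0 ^ 2 + n 1 ^ 2 + n 2 ^ 2 = 1 := hn
  -- The south pole is separate: the general matrix below vanishes there, and a swap of the basis
  -- vectors serves instead.
  by_cases h : n 2 = -1
  · have h0 : n 0 = 0 := by nlinarith [sq_nonneg (n 1)]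
    have h1 : n 1 = 0 := by nlinarith [sq_nonneg (n 0)]
    have hU : !![(0 : ℂ), 1; 1, 0] ∈ Matrix.unitaryGroup (Fin 2) ℂ := by
      rw [Matrix.mem_unitaryGroup_iff]
      ext i j
      fin_cases i <;> fin_cases j <;>
        simp only [Matrix.mul_apply, Fin.sum_univ_two, Matrix.star_apply] <;> simp
    refine ⟨_, hU, key _ hU ?_⟩
    ext i j
    fin_cases i <;> fin_cases j <;> simp [bloch, h, h0, h1]
  · have hpos : 0 < 2 * (1 + n 2) := by
      have : -1 < n 2 := lt_of_le_of_ne (by nlinarith [sq_nonneg (n 0), sq_nonneg (n 1)])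
        (Ne.symm h)
      linarith
    obtain ⟨k, hk⟩ : ∃ k : ℝ, k ^ 2 * (2 * (1 + n 2)) = 1 :=
      ⟨(√(2 * (1 + n 2)))⁻¹, by rw [inv_pow, Real.sq_sqrt hpos.le, inv_mul_cancel₀ hpos.ne']⟩
    have hkc : (k : ℂ) ^ 2 * (2 * (1 + n 2)) = 1 := by exact_mod_cast hk
    have hnc : (n 0 : ℂ) ^ 2 + (n 1 : ℂ) ^ 2 + (n 2 : ℂ) ^ 2 = 1 := by exact_mod_cast hn'
    -- With `N = n·σ` and `Z = σ_z`, this matrix is `k (1 + N Z)`. It intertwines, as `(1 + N Z) Z =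
    -- Z + N = N (1 + N Z)`, and `(1 + N Z)(1 + Z N) = 2 (1 + n 2)` dictates the choice of `k`.
    have hU : (k : ℂ) • !![(1 : ℂ) + n 2, -(n 0 - n 1 * Complex.I);
        n 0 + n 1 * Complex.I, (1 : ℂ) + n 2] ∈ Matrix.unitaryGroup (Fin 2) ℂ := by
      rw [Matrix.mem_unitaryGroup_iff]
      ext i j
      fin_cases i <;> fin_cases j <;>
        simp only [Matrix.mul_apply, Fin.sum_univ_two, Matrix.star_apply] <;> simp <;>
        first
        | linear_combination hkc + (k : ℂ) ^ 2 * hnc - (k : ℂ) ^ 2 * (n 1 : ℂ) ^ 2 * Complex.I_sq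
        | ring
    refine ⟨_, hU, key _ hU ?_⟩
    ext i j
    fin_cases i <;> fin_cases j <;> simp [bloch] <;>
      first
      | linear_combination (k : ℂ) * hnc - (k : ℂ) * (n 1 : ℂ) ^ 2 * Complex.I_sq
      | linear_combination -(k : ℂ) * hnc + (k : ℂ) * (n 1 : ℂ) ^ 2 * Complex.I_sq
      | ring

/-! ### Correlated states -/

lemma correlatedState_conj (a b c : ℝ) (P Q : Matrix (Fin 2) (Fin 2) ℂ)
    {U V : Matrix (Fin 2) (Fin 2) ℂ} (hU : IsUnit U.det) (hV : IsUnit V.det) :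
    (U ⊗ₖ V) * correlatedState a b c P Q * (U⁻¹ ⊗ₖ V⁻¹) =
      correlatedState a b c (U * P * U⁻¹) (V * Q * V⁻¹) := by
  simp only [correlatedState, mul_add, add_mul, Matrix.mul_smul, Matrix.smul_mul,
    ← Matrix.mul_kronecker_mul, mul_one, Matrix.mul_nonsing_inv _ hU,
    Matrix.mul_nonsing_inv _ hV, Matrix.one_kronecker_one]

/-- Diagonal matrices are spanned by `1`, `Z ⊗ 1`, `1 ⊗ Z`, `Z ⊗ Z`, and the coefficients are signed
sums of the eigenvalues; the trace fixes that of `1`. -/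
lemma diagonalState_eq (l₁ l₂ l₃ l₄ : ℝ) (hsum : l₁ + l₂ + l₃ + l₄ = 1) :
    diagonalState l₁ l₂ l₃ l₄ =
      correlatedState (l₁ + l₂ - l₃ - l₄) (l₁ + l₃ - l₂ - l₄) (l₁ + l₄ - l₂ - l₃)
        (bloch ![0, 0, 1]) (bloch ![0, 0, 1]) := by
  have h : (l₁ + l₂ + l₃ + l₄ : ℂ) = 1 := by exact_mod_cast hsum
  ext ⟨i, j⟩ ⟨k, l⟩
  fin_cases i <;> fin_cases j <;> fin_cases k <;> fin_cases l <;>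
    simp [diagonalState, correlatedState, bloch] <;> linear_combination h / 4

/-- The orbit in terms of Bloch vectors. -/
lemma localUnitaryOrbit_correlatedState (a b c : ℝ) :
    localUnitaryOrbit (correlatedState a b c (bloch ![0, 0, 1]) (bloch ![0, 0, 1])) =
      {ρ | ∃ n ∈ blochSphere, ∃ m ∈ blochSphere,
        ρ = correlatedState a b c (bloch n) (bloch m)} := by
  have hdet : ∀ U ∈ Matrix.unitaryGroup (Fin 2) ℂ, IsUnit U.det := fun U hU =>
    Matrix.UnitaryGroup.det_isUnit ⟨U, hU⟩
  have hinv : ∀ U ∈ Matrix.unitaryGroup (Fin 2) ℂ, U⁻¹ = Uᴴ := fun U hU =>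
    Matrix.inv_eq_right_inv (Matrix.mem_unitaryGroup_iff.1 hU)
  have he : ![(0 : ℝ), 0, 1] ∈ blochSphere := by simp [blochSphere]
  -- Unitary conjugation preserves Hermitian traceless involutions, and these are exactly the `bloch
  -- n` with `n` a unit vector.
  have key : ∀ U ∈ Matrix.unitaryGroup (Fin 2) ℂ, ∃ n ∈ blochSphere,
      U * bloch ![0, 0, 1] * U⁻¹ = bloch n := by
    intro U hU
    refine exists_bloch_eq ?_ ?_ ?_
    · simp [hinv U hU, Matrix.conjTranspose_mul, bloch_conjTranspose, mul_assoc]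
    · rw [Matrix.trace_mul_cycle, Matrix.nonsing_inv_mul _ (hdet U hU), one_mul]
      simp [bloch, Matrix.trace_fin_two]
    · calc U * bloch ![0, 0, 1] * U⁻¹ * (U * bloch ![0, 0, 1] * U⁻¹)
          = U * bloch ![0, 0, 1] * (U⁻¹ * U) * bloch ![0, 0, 1] * U⁻¹ := by noncomm_ring
        _ = U * (bloch ![0, 0, 1] * bloch ![0, 0, 1]) * U⁻¹ := by
          rw [Matrix.nonsing_inv_mul _ (hdet U hU)]; noncomm_ring
        _ = 1 := by
          rw [bloch_mul_self he, mul_one, Matrix.mul_nonsing_inv _ (hdet U hU)]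
  ext ρ
  constructor
  · rintro ⟨U, hU, V, hV, rfl⟩
    obtain ⟨n, hn, h1⟩ := key U hU
    obtain ⟨m, hm, h2⟩ := key V hV
    exact ⟨n, hn, m, hm, by rw [correlatedState_conj a b c _ _ (hdet U hU) (hdet V hV), h1, h2]⟩
  · rintro ⟨n, hn, m, hm, rfl⟩
    obtain ⟨U, hU, h1⟩ := exists_unitary_conj_eq_bloch hn
    obtain ⟨V, hV, h2⟩ := exists_unitary_conj_eq_bloch hm
    exact ⟨U, hU, V, hV, by rw [correlatedState_conj a b c _ _ (hdet U hU) (hdet V hV), h1, h2]⟩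

lemma trace_bloch (n : Fin 3 → ℝ) : (bloch n).trace = 0 := by
  simp [bloch, Matrix.trace_fin_two]

/-- The correlation `c` disappears: against `X ⊗ 1` or `1 ⊗ Y`, the term `P ⊗ Q` leaves a factor `tr
Q` or `tr P`, which is zero. This is why the volume involves only `a` and `b`. -/
lemma trace_correlatedState_mul (a b c : ℝ) {P Q : Matrix (Fin 2) (Fin 2) ℂ}
    (hP : P.trace = 0) (hQ : Q.trace = 0) (X Y : Matrix (Fin 2) (Fin 2) ℂ) :
    (correlatedState a b c P Q * (X ⊗ₖ 1 + 1 ⊗ₖ Y)).trace =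
      (X.trace + a * (P * X).trace + Y.trace + b * (Q * Y).trace) / 2 := by
  simp only [correlatedState, mul_add, add_mul, Matrix.smul_mul,
    ← Matrix.mul_kronecker_mul, mul_one, one_mul, Matrix.trace_add, Matrix.trace_smul,
    Matrix.trace_kronecker, hP, hQ, Matrix.trace_one, smul_eq_mul, Fintype.card_fin]
  push_cast
  ring

lemma lie_correlatedState (a b c : ℝ) (P Q X Y : Matrix (Fin 2) (Fin 2) ℂ) :
    ⁅X ⊗ₖ 1 + 1 ⊗ₖ Y, correlatedState a b c P Q⁆ =
      (1 / 4 : ℂ) • ((a : ℂ) • ⁅X, P⁆ ⊗ₖ 1 + (b : ℂ) • 1 ⊗ₖ ⁅Y, Q⁆ +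
        (c : ℂ) • (⁅X, P⁆ ⊗ₖ Q + P ⊗ₖ ⁅Y, Q⁆)) := by
  have s1 : ∀ A B C : Matrix (Fin 2) (Fin 2) ℂ, (A - B) ⊗ₖ C = A ⊗ₖ C - B ⊗ₖ C :=
    fun A B C => by ext; simp [sub_mul]
  have s2 : ∀ A B C : Matrix (Fin 2) (Fin 2) ℂ, C ⊗ₖ (A - B) = C ⊗ₖ A - C ⊗ₖ B :=
    fun A B C => by ext; simp [mul_sub]
  simp only [correlatedState, Ring.lie_def, mul_add, add_mul, Matrix.mul_smul, Matrix.smul_mul,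
    ← Matrix.mul_kronecker_mul, mul_one, one_mul, s1, s2]
  module

lemma lie_kronecker_add (X Y X' Y' : Matrix (Fin 2) (Fin 2) ℂ) :
    ⁅X ⊗ₖ 1 + 1 ⊗ₖ Y, X' ⊗ₖ 1 + 1 ⊗ₖ Y'⁆ = ⁅X, X'⁆ ⊗ₖ 1 + 1 ⊗ₖ ⁅Y, Y'⁆ := by
  have s1 : ∀ A B C : Matrix (Fin 2) (Fin 2) ℂ, (A - B) ⊗ₖ C = A ⊗ₖ C - B ⊗ₖ C :=
    fun A B C => by ext; simp [sub_mul]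
  have s2 : ∀ A B C : Matrix (Fin 2) (Fin 2) ℂ, C ⊗ₖ (A - B) = C ⊗ₖ A - C ⊗ₖ B :=
    fun A B C => by ext; simp [mul_sub]
  simp only [Ring.lie_def, mul_add, add_mul, ← Matrix.mul_kronecker_mul, mul_one, one_mul, s1, s2]
  abel

/-! ### The symplectic form in terms of Bloch vectors -/

/-- The generator of the infinitesimal rotation which moves `n` with velocity `u`. -/
def blochGenerator (n u : Fin 3 → ℝ) : Matrix (Fin 2) (Fin 2) ℂ :=
  (1 / 2 : ℂ) • (bloch u * bloch n)

/-- The tangent space at `n` of the unit sphere. -/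
def IsBlochTangent (n u : Fin 3 → ℝ) : Prop := n 0 * u 0 + n 1 * u 1 + n 2 * u 2 = 0

lemma bloch_anticomm {n u : Fin 3 → ℝ} (h : IsBlochTangent n u) :
    bloch n * bloch u = -(bloch u * bloch n) := by
  rw [← add_eq_zero_iff_eq_neg, bloch_mul_bloch_add, show _ = (0 : ℝ) from h]
  simp

lemma blochGenerator_conjTranspose {n u : Fin 3 → ℝ} (h : IsBlochTangent n u) :
    (blochGenerator n u)ᴴ = -blochGenerator n u := by
  rw [blochGenerator, Matrix.conjTranspose_smul, Matrix.conjTranspose_mul, bloch_conjTranspose,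
    bloch_conjTranspose, bloch_anticomm h]
  simp

/-- Tangency makes `bloch n` and `bloch u` anticommute, and `bloch n` squares to one, so `(u n n - n
u n) / 2 = u`. -/
lemma lie_blochGenerator {n u : Fin 3 → ℝ} (hn : n ∈ blochSphere) (h : IsBlochTangent n u) :
    ⁅blochGenerator n u, bloch n⁆ = bloch u := by
  rw [Ring.lie_def, blochGenerator, Matrix.smul_mul, Matrix.mul_smul, mul_assoc,
    bloch_mul_self hn, ← mul_assoc, bloch_anticomm h, neg_mul, mul_assoc, bloch_mul_self hn, mul_one]
  module

lemma lie_blochGenerator_blochGenerator {n u v : Fin 3 → ℝ} (hn : n ∈ blochSphere)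
    (hu : IsBlochTangent n u) (hv : IsBlochTangent n v) :
    ⁅blochGenerator n u, blochGenerator n v⁆ =
      (-1 / 4 : ℂ) • (bloch u * bloch v - bloch v * bloch u) := by
  have key : ∀ {u v : Fin 3 → ℝ}, IsBlochTangent n v →
      blochGenerator n u * blochGenerator n v = (-1 / 4 : ℂ) • (bloch u * bloch v) := by
    intro u v hv
    rw [blochGenerator, blochGenerator, Matrix.smul_mul, Matrix.mul_smul, mul_assoc,
      ← mul_assoc (bloch n), bloch_anticomm hv, neg_mul, mul_assoc, bloch_mul_self hn]
    simp only [mul_one, mul_neg]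
    module
  rw [Ring.lie_def, key hv, key hu, smul_sub]

/-- The oriented volume of the parallelepiped spanned by three vectors. -/
def tripleProduct (n u v : Fin 3 → ℝ) : ℝ :=
  n 0 * (u 1 * v 2 - u 2 * v 1) + n 1 * (u 2 * v 0 - u 0 * v 2) + n 2 * (u 0 * v 1 - u 1 * v 0)

lemma trace_bloch_mul_commutator (n u v : Fin 3 → ℝ) :
    (bloch n * (bloch u * bloch v - bloch v * bloch u)).trace =
      4 * Complex.I * (tripleProduct n u v : ℂ) := by
  simp [bloch, tripleProduct, Matrix.trace_fin_two]
  ring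

/-- The velocity of `correlatedState a b c (bloch n) (bloch m)` when `n` and `m` have velocities
`u` and `v`. -/
def correlatedVelocity (a b c : ℝ) (n m u v : Fin 3 → ℝ) : TwoQubitMatrix :=
  (1 / 4 : ℂ) • ((a : ℂ) • bloch u ⊗ₖ 1 + (b : ℂ) • 1 ⊗ₖ bloch v +
    (c : ℂ) • (bloch u ⊗ₖ bloch m + bloch n ⊗ₖ bloch v))

/-- The velocities are brackets of `ρ` with explicit elements of `𝔨`, so `kksForm_apply` evaluates
the form. On a tangent plane of the sphere the triple product with `n` is the area form. -/
lemma kksForm_correlatedVelocity (a b c : ℝ) {n m u v u' v' : Fin 3 → ℝ} (hn : n ∈ blochSphere)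
    (hm : m ∈ blochSphere) (hu : IsBlochTangent n u) (hv : IsBlochTangent m v)
    (hu' : IsBlochTangent n u') (hv' : IsBlochTangent m v') :
    kksForm (correlatedState a b c (bloch n) (bloch m)) (correlatedVelocity a b c n m u v)
      (correlatedVelocity a b c n m u' v') =
      -(a / 2) * tripleProduct n u u' - b / 2 * tripleProduct m v v' := by
  have key : ∀ {u v}, IsBlochTangent n u → IsBlochTangent m v →
      correlatedVelocity a b c n m u v =
        ⁅blochGenerator n u ⊗ₖ 1 + 1 ⊗ₖ blochGenerator m v,
          correlatedState a b c (bloch n) (bloch m)⁆ := by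
    intro u v hu hv
    rw [lie_correlatedState, lie_blochGenerator hn hu, lie_blochGenerator hm hv]
    rfl
  have hmem : ∀ {u v}, IsBlochTangent n u → IsBlochTangent m v →
      blochGenerator n u ⊗ₖ 1 + 1 ⊗ₖ blochGenerator m v ∈ localUnitaryLieAlgebra :=
    fun hu hv => ⟨_, _, blochGenerator_conjTranspose hu, blochGenerator_conjTranspose hv, rfl⟩
  have ht : ∀ A B : Matrix (Fin 2) (Fin 2) ℂ, (A * B - B * A).trace = 0 := fun A B => by
    rw [Matrix.trace_sub, Matrix.trace_mul_comm, sub_self]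
  rw [key hu hv, key hu' hv', kksForm_apply _ (hmem hu hv) (hmem hu' hv'), hsPairing,
    lie_kronecker_add, trace_correlatedState_mul a b c (trace_bloch n) (trace_bloch m),
    lie_blochGenerator_blochGenerator hn hu hu', lie_blochGenerator_blochGenerator hm hv hv']
  simp only [Matrix.mul_smul, Matrix.trace_smul, trace_bloch_mul_commutator, ht, smul_eq_mul]
  have e : ∀ x y : ℝ, -Complex.I * ((-1 / 4 * 0 + a * (-1 / 4 * (4 * Complex.I * (x : ℂ))) +
      -1 / 4 * 0 + b * (-1 / 4 * (4 * Complex.I * (y : ℂ)))) / 2) =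
      ((-(a / 2) * x - b / 2 * y : ℝ) : ℂ) := by
    intro x y
    push_cast
    linear_combination (a * x / 2 + b * y / 2 : ℂ) * Complex.I_sq
  rw [e, Complex.ofReal_re]

end

noncomputable section

/-! ### Stereographic charts of the sphere -/

/-- The inverse stereographic projection; `s = 1` and `s = -1` are the two choices of the pole. -/
def stereo (s x y : ℝ) : Fin 3 → ℝ :=
  ![2 * x / (1 + x ^ 2 + y ^ 2), 2 * y / (1 + x ^ 2 + y ^ 2),
    s * (1 - x ^ 2 - y ^ 2) / (1 + x ^ 2 + y ^ 2)]

/-- The derivative of `stereo s` at `(x, y)` in the direction `(p, q)`. -/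
def stereoVelocity (s x y p q : ℝ) : Fin 3 → ℝ :=
  ![(2 * (1 - x ^ 2 + y ^ 2) * p - 4 * x * y * q) / (1 + x ^ 2 + y ^ 2) ^ 2,
    (2 * (1 + x ^ 2 - y ^ 2) * q - 4 * x * y * p) / (1 + x ^ 2 + y ^ 2) ^ 2,
    -4 * s * (x * p + y * q) / (1 + x ^ 2 + y ^ 2) ^ 2]

lemma stereo_mem_blochSphere {s : ℝ} (hs : s ^ 2 = 1) (x y : ℝ) : stereo s x y ∈ blochSphere := by
  have h : 1 + x ^ 2 + y ^ 2 ≠ 0 := by positivity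
  simp only [blochSphere, stereo, Set.mem_ofPred_eq, Matrix.cons_val]
  field_simp
  linear_combination (1 - x ^ 2 - y ^ 2) ^ 2 * hs

lemma isBlochTangent_stereo {s : ℝ} (hs : s ^ 2 = 1) (x y p q : ℝ) :
    IsBlochTangent (stereo s x y) (stereoVelocity s x y p q) := by
  have h : 1 + x ^ 2 + y ^ 2 ≠ 0 := by positivity
  simp only [IsBlochTangent, stereo, stereoVelocity, Matrix.cons_val]
  field_simp
  linear_combination (-4 * (x * p + y * q) * (1 - x ^ 2 - y ^ 2)) * hs

/-- The area form in stereographic coordinates; the sign `s` records the orientation of the chart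
and is lost in the density. -/
lemma tripleProduct_stereo (s x y p q p' q' : ℝ) :
    tripleProduct (stereo s x y) (stereoVelocity s x y p q) (stereoVelocity s x y p' q') =
      4 * s / (1 + x ^ 2 + y ^ 2) ^ 2 * (p * q' - q * p') := by
  have h : 1 + x ^ 2 + y ^ 2 ≠ 0 := by positivity
  simp only [tripleProduct, stereo, stereoVelocity, Matrix.cons_val]
  field_simp
  ring

lemma stereo_leftInverse {s : ℝ} (hs : s ^ 2 = 1) {n : Fin 3 → ℝ} (hn : n ∈ blochSphere)
    (h : 1 + s * n 2 ≠ 0) :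
    stereo s (n 0 / (1 + s * n 2)) (n 1 / (1 + s * n 2)) = n := by
  have hn' : n 0 ^ 2 + n 1 ^ 2 + n 2 ^ 2 = 1 := hn
  have hD : 1 + (n 0 / (1 + s * n 2)) ^ 2 + (n 1 / (1 + s * n 2)) ^ 2 = 2 / (1 + s * n 2) := by
    field_simp
    linear_combination hn' + (n 2) ^ 2 * hs
  have hN : 1 - (n 0 / (1 + s * n 2)) ^ 2 - (n 1 / (1 + s * n 2)) ^ 2 =
      2 * (s * n 2) / (1 + s * n 2) := by
    have h2 : 2 = 2 * (s * n 2) / (1 + s * n 2) + 2 / (1 + s * n 2) := by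
      field_simp
      ring
    linear_combination -hD + h2
  ext i
  rw [stereo, hD, hN]
  fin_cases i
  · simp; field_simp
  · simp; field_simp
  · simp; field_simp; linear_combination (n 2) * hs

lemma one_add_mul_stereo {s : ℝ} (hs : s ^ 2 = 1) (x y : ℝ) :
    1 + s * stereo s x y 2 = 2 / (1 + x ^ 2 + y ^ 2) := by
  have h : 1 + x ^ 2 + y ^ 2 ≠ 0 := by positivity
  simp only [stereo, Matrix.cons_val]
  field_simp
  linear_combination (1 - x ^ 2 - y ^ 2) * hs

/-- The chart with `s = 1` never reaches the point with third coordinate -1, and the one with `s =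
-1` reaches it only at the origin. The weaker conclusion `x = 0` suffices, since a hyperplane is
null. -/
lemma one_add_stereo_eq_zero {s x y : ℝ} (hs : s = 1 ∨ s = -1) (h : 1 + stereo s x y 2 = 0) :
    x = 0 := by
  have h0 : 0 < 1 + x ^ 2 + y ^ 2 := by positivity
  simp only [stereo, Matrix.cons_val] at h
  field_simp at h
  rcases hs with rfl | rfl
  · linarith
  · nlinarith [sq_nonneg x, sq_nonneg y]

lemma hasDerivAt_stereo (s x y p q : ℝ) :
    HasDerivAt (fun t : ℝ => stereo s (x + t * p) (y + t * q)) (stereoVelocity s x y p q) 0 := by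
  have hx : HasDerivAt (fun t : ℝ => x + t * p) p 0 := by
    simpa using ((hasDerivAt_id (0 : ℝ)).mul_const p).const_add x
  have hy : HasDerivAt (fun t : ℝ => y + t * q) q 0 := by
    simpa using ((hasDerivAt_id (0 : ℝ)).mul_const q).const_add y
  have hD := ((hx.fun_pow 2).const_add 1).fun_add (hy.fun_pow 2)
  have h : 1 + x ^ 2 + y ^ 2 ≠ 0 := by positivity
  have h' : 1 + (x + 0 * p) ^ 2 + (y + 0 * q) ^ 2 ≠ 0 := by positivity
  rw [hasDerivAt_pi]
  intro i
  fin_cases i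
  · refine ((hx.const_mul 2).fun_div hD h').congr_deriv ?_
    simp [stereoVelocity]
    field_simp
    ring
  · refine ((hy.const_mul 2).fun_div hD h').congr_deriv ?_
    simp [stereoVelocity]
    field_simp
    ring
  · refine (((((hx.fun_pow 2).const_sub 1).fun_sub (hy.fun_pow 2)).const_mul s).fun_div
      hD h').congr_deriv ?_
    simp [stereoVelocity]
    field_simp
    ring

lemma contDiff_stereo {E : Type*} [NormedAddCommGroup E] [NormedSpace ℝ E] (s : ℝ) {f g : E → ℝ}
    (hf : ContDiff ℝ ∞ f) (hg : ContDiff ℝ ∞ g) : ContDiff ℝ ∞ fun v => stereo s (f v) (g v) := by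
  rw [contDiff_pi]
  intro i
  have h : ∀ v, 1 + f v ^ 2 + g v ^ 2 ≠ 0 := fun v => by positivity
  fin_cases i
  · exact ContDiff.div (by fun_prop) (by fun_prop) h
  · exact ContDiff.div (by fun_prop) (by fun_prop) h
  · exact ContDiff.div (by fun_prop) (by fun_prop) h

/-! ### Charts of the orbit -/

lemma contDiff_bloch_apply {E : Type*} [NormedAddCommGroup E] [NormedSpace ℝ E]
    {n : E → Fin 3 → ℝ} (hn : ContDiff ℝ ∞ n) (i j : Fin 2) :
    ContDiff ℝ ∞ fun v => bloch (n v) i j := by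
  have h : ∀ k, ContDiff ℝ ∞ fun v => (n v k : ℂ) := fun k =>
    Complex.ofRealCLM.contDiff.comp (contDiff_pi.1 hn k)
  fin_cases i <;> fin_cases j
  · exact h 2
  · exact (h 0).sub ((h 1).mul contDiff_const)
  · exact (h 0).add ((h 1).mul contDiff_const)
  · exact (h 2).neg

lemma contDiff_correlatedState {E : Type*} [NormedAddCommGroup E] [NormedSpace ℝ E] (a b c : ℝ)
    {n m : E → Fin 3 → ℝ} (hn : ContDiff ℝ ∞ n) (hm : ContDiff ℝ ∞ m) :
    ContDiff ℝ ∞ fun v => correlatedState a b c (bloch (n v)) (bloch (m v)) := by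
  refine contDiff_pi.2 fun i => contDiff_pi.2 fun j => ?_
  have h1 := contDiff_bloch_apply hn i.1 j.1
  have h2 := contDiff_bloch_apply hm i.2 j.2
  simp only [correlatedState, Matrix.smul_apply, Matrix.add_apply, Matrix.kroneckerMap_apply,
    smul_eq_mul]
  fun_prop

lemma hasDerivAt_bloch_apply {n : ℝ → Fin 3 → ℝ} {u : Fin 3 → ℝ} {t : ℝ} (hn : HasDerivAt n u t)
    (i j : Fin 2) : HasDerivAt (fun t => bloch (n t) i j) (bloch u i j) t := by
  have h : ∀ k, HasDerivAt (fun t => (n t k : ℂ)) (u k : ℂ) t := fun k =>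
    (hasDerivAt_pi.1 hn k).ofReal_comp
  fin_cases i <;> fin_cases j
  · exact h 2
  · exact (h 0).sub ((h 1).mul_const _)
  · exact (h 0).add ((h 1).mul_const _)
  · exact (h 2).neg

lemma hasDerivAt_correlatedState (a b c : ℝ) {n m : ℝ → Fin 3 → ℝ} {u v : Fin 3 → ℝ} {t : ℝ}
    (hn : HasDerivAt n u t) (hm : HasDerivAt m v t) :
    HasDerivAt (fun t => correlatedState a b c (bloch (n t)) (bloch (m t)))
      (correlatedVelocity a b c (n t) (m t) u v) t := by
  refine hasDerivAt_pi.2 fun i => hasDerivAt_pi.2 fun j => ?_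
  have h1 := hasDerivAt_bloch_apply hn i.1 j.1
  have h2 := hasDerivAt_bloch_apply hm i.2 j.2
  simp only [correlatedState, correlatedVelocity, Matrix.smul_apply, Matrix.add_apply,
    Matrix.kroneckerMap_apply, smul_eq_mul]
  refine (((((h1.mul_const _).const_mul (a : ℂ)).const_add _).fun_add
    ((h2.const_mul _).const_mul (b : ℂ))).fun_add
    ((h1.fun_mul h2).const_mul (c : ℂ))).const_mul _ |>.congr_deriv ?_
  ring

instance : @BorelSpace TwoQubitMatrix PseudoMetricSpace.toUniformSpace.toTopologicalSpace _ := ⟨rfl⟩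

/-- The chart of the orbit which is the product of two stereographic charts. -/
def orbitChart (a b c s t : ℝ) (v : Fin (2 * 2) → ℝ) : TwoQubitMatrix :=
  correlatedState a b c (bloch (stereo s (v 0) (v 1))) (bloch (stereo t (v 2) (v 3)))

lemma contDiff_orbitChart (a b c s t : ℝ) : ContDiff ℝ ∞ (orbitChart a b c s t) :=
  contDiff_correlatedState a b c
    (contDiff_stereo s (contDiff_apply ℝ ℝ 0) (contDiff_apply ℝ ℝ 1))
    (contDiff_stereo t (contDiff_apply ℝ ℝ 2) (contDiff_apply ℝ ℝ 3))

lemma differentiable_orbitChart (a b c s t : ℝ) : Differentiable ℝ (orbitChart a b c s t) :=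
  (contDiff_orbitChart a b c s t).differentiable (by simp)

lemma hasDerivAt_orbitChart (a b c s t : ℝ) (v u : Fin (2 * 2) → ℝ) :
    HasDerivAt (fun r : ℝ => orbitChart a b c s t (v + r • u))
      (correlatedVelocity a b c (stereo s (v 0) (v 1)) (stereo t (v 2) (v 3))
        (stereoVelocity s (v 0) (v 1) (u 0) (u 1))
        (stereoVelocity t (v 2) (v 3) (u 2) (u 3))) 0 := by
  have h := hasDerivAt_correlatedState a b c (hasDerivAt_stereo s (v 0) (v 1) (u 0) (u 1))
    (hasDerivAt_stereo t (v 2) (v 3) (u 2) (u 3))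
  simp only [zero_mul, add_zero] at h
  exact h

lemma pullbackForm_orbitChart (a b c : ℝ) {s t : ℝ} (hs : s ^ 2 = 1) (ht : t ^ 2 = 1)
    (v u w : Fin (2 * 2) → ℝ) :
    pullbackForm kksForm (orbitChart a b c s t) v u w =
      -(2 * a * s / (1 + v 0 ^ 2 + v 1 ^ 2) ^ 2) * (u 0 * w 1 - u 1 * w 0) +
        -(2 * b * t / (1 + v 2 ^ 2 + v 3 ^ 2) ^ 2) * (u 2 * w 3 - u 3 * w 2) := by
  rw [pullbackForm_eq kksForm (differentiable_orbitChart a b c s t v)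
    (hasDerivAt_orbitChart a b c s t v u) (hasDerivAt_orbitChart a b c s t v w), orbitChart,
    kksForm_correlatedVelocity a b c
    (stereo_mem_blochSphere hs _ _) (stereo_mem_blochSphere ht _ _)
    (isBlochTangent_stereo hs _ _ _ _) (isBlochTangent_stereo ht _ _ _ _)
    (isBlochTangent_stereo hs _ _ _ _) (isBlochTangent_stereo ht _ _ _ _),
    tripleProduct_stereo, tripleProduct_stereo]
  ring

/-- The map `J` is kept general: the identity yields the density, and the derivative of a transition
map yields the hypothesis `hΩ` of `chartMeasure_inter_le`. -/
lemma pfaffian_orbitChart (a b c : ℝ) {s t : ℝ} (hs : s ^ 2 = 1) (ht : t ^ 2 = 1)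
    (v : Fin (2 * 2) → ℝ) (J : (Fin (2 * 2) → ℝ) →L[ℝ] (Fin (2 * 2) → ℝ)) :
    pfaffian 2 (fun i j => pullbackForm kksForm (orbitChart a b c s t) v (J (Pi.single i 1))
        (J (Pi.single j 1))) =
      J.det * (-(2 * a * s / (1 + v 0 ^ 2 + v 1 ^ 2) ^ 2) *
        -(2 * b * t / (1 + v 2 ^ 2 + v 3 ^ 2) ^ 2)) := by
  have hdet : J.det = (LinearMap.toMatrix' (J : (Fin (2 * 2) → ℝ) →ₗ[ℝ] _)).det :=
    (LinearMap.det_toMatrix' _).symm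
  rw [hdet]
  refine pfaffian_two_congr _ _ _ _ fun i j => ?_
  simp only [pullbackForm_orbitChart a b c hs ht, LinearMap.toMatrix'_apply,
    ContinuousLinearMap.coe_coe]

lemma liouvilleDensity_orbitChart {a b : ℝ} (ha : 0 < a) (hb : 0 < b) (c : ℝ) {s t : ℝ}
    (hs : s ^ 2 = 1) (ht : t ^ 2 = 1) (v : Fin (2 * 2) → ℝ) :
    liouvilleDensity 2 kksForm (orbitChart a b c s t) v =
      a * b * (1 / (Real.pi * (1 + v 0 ^ 2 + v 1 ^ 2) ^ 2)) *
        (1 / (Real.pi * (1 + v 2 ^ 2 + v 3 ^ 2) ^ 2)) := by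
  have h := pfaffian_orbitChart a b c hs ht v (ContinuousLinearMap.id ℝ _)
  have hpi := Real.pi_pos
  have abs_sign : ∀ {s : ℝ}, s ^ 2 = 1 → |s| = 1 := fun hs => by
    rwa [← sq_eq_sq₀ (abs_nonneg _) zero_le_one, sq_abs, one_pow]
  simp only [ContinuousLinearMap.coe_id', id] at h
  rw [liouvilleDensity_eq, h, ContinuousLinearMap.det, ContinuousLinearMap.coe_id,
    LinearMap.det_id]
  simp only [abs_mul, abs_div, abs_neg, abs_pow, abs_sign hs, abs_sign ht, abs_of_pos ha, abs_of_pos hb]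
  rw [abs_of_pos (by positivity : 0 < 1 + v 0 ^ 2 + v 1 ^ 2),
    abs_of_pos (by positivity : 0 < 1 + v 2 ^ 2 + v 3 ^ 2)]
  norm_num
  field_simp

lemma chartMeasure_orbitChart_univ {a b : ℝ} (ha : 0 < a) (hb : 0 < b) (c : ℝ) {s t : ℝ}
    (hs : s ^ 2 = 1) (ht : t ^ 2 = 1) :
    chartMeasure 2 kksForm Set.univ (orbitChart a b c s t) Set.univ = ENNReal.ofReal (a * b) := by
  have hpi := Real.pi_pos
  rw [chartMeasure_apply _ MeasurableSet.univ
    (differentiable_orbitChart a b c s t).continuous.continuousOn MeasurableSet.univ,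
    Set.preimage_univ, Set.univ_inter, Measure.restrict_univ]
  have h : ∀ v : Fin (2 * 2) → ℝ,
      ENNReal.ofReal (liouvilleDensity 2 kksForm (orbitChart a b c s t) v) =
      ENNReal.ofReal (a * b) *
        (ENNReal.ofReal (1 / (Real.pi * (1 + v 0 ^ 2 + v 1 ^ 2) ^ 2)) *
        ENNReal.ofReal (1 / (Real.pi * (1 + v 2 ^ 2 + v 3 ^ 2) ^ 2))) := by
    intro v
    rw [liouvilleDensity_orbitChart ha hb c hs ht, ← ENNReal.ofReal_mul (by positivity),
      ← ENNReal.ofReal_mul (by positivity), mul_assoc]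
  let F : ℝ × ℝ → ℝ≥0∞ := fun p =>
    ENNReal.ofReal (1 / (Real.pi * (1 + p.1 ^ 2 + p.2 ^ 2) ^ 2))
  have hF : Measurable F := by fun_prop
  simp only [h]
  rw [lintegral_const_mul' _ _ ENNReal.ofReal_ne_top]
  change _ * ∫⁻ v : Fin (2 * 2) → ℝ, F (v 0, v 1) * F (v 2, v 3) = _
  rw [lintegral_fin_four_mul F F hF hF, lintegral_fubiniStudy, mul_one, mul_one]

end

noncomputable section

/-! ### Bloch vectors as functions of the state -/

/-- Pairing with `𝔨` reads off `a n` and `b m`, so the Bloch vectors are restrictions of real-linear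
functions of the state. Both the injectivity and the inverse charts rest on this. -/
lemma hsPairing_correlatedState (a b c : ℝ) (n m u v : Fin 3 → ℝ) :
    hsPairing (correlatedState a b c (bloch n) (bloch m))
        ((Complex.I • bloch u) ⊗ₖ 1 + 1 ⊗ₖ (Complex.I • bloch v)) =
      a * (n 0 * u 0 + n 1 * u 1 + n 2 * u 2) + b * (m 0 * v 0 + m 1 * v 1 + m 2 * v 2) := by
  have key : ∀ n u, (bloch n * bloch u).trace =
      ((2 * (n 0 * u 0 + n 1 * u 1 + n 2 * u 2) : ℝ) : ℂ) := by
    intro n u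
    have h := congrArg Matrix.trace (bloch_mul_bloch_add n u)
    rw [Matrix.trace_add, Matrix.trace_mul_comm (bloch u), Matrix.trace_smul,
      Matrix.trace_one, Fintype.card_fin, smul_eq_mul] at h
    push_cast at h ⊢
    linear_combination h / 2
  rw [hsPairing, trace_correlatedState_mul a b c (trace_bloch n) (trace_bloch m)]
  simp only [Matrix.mul_smul, Matrix.trace_smul, trace_bloch, key, smul_eq_mul]
  rw [← Complex.ofReal_re (a * (n 0 * u 0 + n 1 * u 1 + n 2 * u 2) +
    b * (m 0 * v 0 + m 1 * v 1 + m 2 * v 2))]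
  congr 1
  push_cast
  linear_combination -(a * (n 0 * u 0 + n 1 * u 1 + n 2 * u 2) +
    b * (m 0 * v 0 + m 1 * v 1 + m 2 * v 2) : ℂ) * Complex.I_sq

/-- The element `i (u · σ) ⊗ 1 + 1 ⊗ i (v · σ)` of `𝔨`. -/
def blochDirection (u v : Fin 3 → ℝ) : TwoQubitMatrix :=
  (Complex.I • bloch u) ⊗ₖ 1 + 1 ⊗ₖ (Complex.I • bloch v)

lemma blochDirection_mem (u v : Fin 3 → ℝ) : blochDirection u v ∈ localUnitaryLieAlgebra := by
  have h : ∀ u, (Complex.I • bloch u)ᴴ = -(Complex.I • bloch u) := fun u => by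
    simp [Matrix.conjTranspose_smul, bloch_conjTranspose]
  exact ⟨_, _, h u, h v, rfl⟩

/-- The Bloch vector of the first factor, as a function of the state. -/
def blochFst (a : ℝ) (ρ : TwoQubitMatrix) (k : Fin 3) : ℝ :=
  a⁻¹ * hsPairing ρ (blochDirection (Pi.single k 1) 0)

/-- The Bloch vector of the second factor, as a function of the state. -/
def blochSnd (b : ℝ) (ρ : TwoQubitMatrix) (k : Fin 3) : ℝ :=
  b⁻¹ * hsPairing ρ (blochDirection 0 (Pi.single k 1))

lemma blochFst_correlatedState {a : ℝ} (ha : a ≠ 0) (b c : ℝ) (n m : Fin 3 → ℝ) :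
    blochFst a (correlatedState a b c (bloch n) (bloch m)) = n := by
  ext k
  rw [blochFst, blochDirection, hsPairing_correlatedState]
  fin_cases k <;> simp [ha]

lemma blochSnd_correlatedState {b : ℝ} (hb : b ≠ 0) (a c : ℝ) (n m : Fin 3 → ℝ) :
    blochSnd b (correlatedState a b c (bloch n) (bloch m)) = m := by
  ext k
  rw [blochSnd, blochDirection, hsPairing_correlatedState]
  fin_cases k <;> simp [hb]

lemma differentiable_hsPairing (X : TwoQubitMatrix) : Differentiable ℝ fun ρ => hsPairing ρ X := by
  let f : TwoQubitMatrix →ₗ[ℝ] ℝ :=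
    { toFun := fun ρ => hsPairing ρ X
      map_add' := fun ρ σ => by simp [hsPairing, add_mul, mul_add]
      map_smul' := fun r ρ => by simp [hsPairing] }
  exact f.toContinuousLinearMap.differentiable

lemma differentiable_blochFst (a : ℝ) (k : Fin 3) :
    Differentiable ℝ fun ρ => blochFst a ρ k :=
  (differentiable_hsPairing _).const_mul a⁻¹

lemma differentiable_blochSnd (b : ℝ) (k : Fin 3) :
    Differentiable ℝ fun ρ => blochSnd b ρ k :=
  (differentiable_hsPairing _).const_mul b⁻¹

/-- The set of the states with Bloch vectors `n`, `m` such that `n` and `m` are unit vectors. -/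
def blochOrbit (a b c : ℝ) : Set TwoQubitMatrix :=
  {ρ | ∃ n ∈ blochSphere, ∃ m ∈ blochSphere, ρ = correlatedState a b c (bloch n) (bloch m)}

lemma injOn_coadjointPoint {a b : ℝ} (ha : a ≠ 0) (hb : b ≠ 0) (c : ℝ) :
    Set.InjOn coadjointPoint (blochOrbit a b c) := by
  rintro ρ ⟨n, -, m, -, hρ⟩ σ ⟨n', -, m', -, hσ⟩ h
  have key : ∀ u v, hsPairing ρ (blochDirection u v) = hsPairing σ (blochDirection u v) :=
    fun u v => congrFun h ⟨_, blochDirection_mem u v⟩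
  have h1 : blochFst a ρ = blochFst a σ := by
    ext k
    rw [blochFst, blochFst, key]
  have h2 : blochSnd b ρ = blochSnd b σ := by
    ext k
    rw [blochSnd, blochSnd, key]
  rw [hρ, hσ, blochFst_correlatedState ha, blochFst_correlatedState ha] at h1
  rw [hρ, hσ, blochSnd_correlatedState hb, blochSnd_correlatedState hb] at h2
  rw [hρ, hσ, h1, h2]

/-- The left inverse of `orbitChart a b c s t`. -/
def orbitCoord (a b s t : ℝ) (ρ : TwoQubitMatrix) : Fin (2 * 2) → ℝ :=
  ![blochFst a ρ 0 / (1 + s * blochFst a ρ 2), blochFst a ρ 1 / (1 + s * blochFst a ρ 2),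
    blochSnd b ρ 0 / (1 + t * blochSnd b ρ 2), blochSnd b ρ 1 / (1 + t * blochSnd b ρ 2)]

/-- The domain of `orbitCoord a b s t`. -/
def orbitDomain (a b s t : ℝ) : Set TwoQubitMatrix :=
  {ρ | 1 + s * blochFst a ρ 2 ≠ 0 ∧ 1 + t * blochSnd b ρ 2 ≠ 0}

lemma isOpen_orbitDomain (a b s t : ℝ) : IsOpen (orbitDomain a b s t) := by
  have h1 := (differentiable_blochFst a 2).continuous
  have h2 := (differentiable_blochSnd b 2).continuous
  exact (isOpen_ne_fun (continuous_const.add (continuous_const.mul h1)) continuous_const).inter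
    (isOpen_ne_fun (continuous_const.add (continuous_const.mul h2)) continuous_const)

lemma differentiableOn_stereoCoord {V : Type*} [NormedAddCommGroup V] [NormedSpace ℝ V]
    {n m : V → Fin 3 → ℝ} (hn : ∀ k, Differentiable ℝ fun ρ => n ρ k)
    (hm : ∀ k, Differentiable ℝ fun ρ => m ρ k) (s t : ℝ) :
    DifferentiableOn ℝ
      (fun ρ => (![n ρ 0 / (1 + s * n ρ 2), n ρ 1 / (1 + s * n ρ 2),
        m ρ 0 / (1 + t * m ρ 2), m ρ 1 / (1 + t * m ρ 2)] : Fin (2 * 2) → ℝ))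
      {ρ | 1 + s * n ρ 2 ≠ 0 ∧ 1 + t * m ρ 2 ≠ 0} := by
  have h1 := fun k =>
    (hn k).differentiableOn (s := {ρ | 1 + s * n ρ 2 ≠ 0 ∧ 1 + t * m ρ 2 ≠ 0})
  have h2 := fun k =>
    (hm k).differentiableOn (s := {ρ | 1 + s * n ρ 2 ≠ 0 ∧ 1 + t * m ρ 2 ≠ 0})
  have div : ∀ {f g : V → ℝ} {A : Set V}, DifferentiableOn ℝ f A → DifferentiableOn ℝ g A →
      (∀ ρ ∈ A, g ρ ≠ 0) → DifferentiableOn ℝ (fun ρ => f ρ / g ρ) A :=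
    fun hf hg h => by
      simp only [div_eq_mul_inv]
      exact hf.fun_mul (hg.fun_inv h)
  refine differentiableOn_pi.2 fun i => ?_
  fin_cases i
  · exact div (h1 0) (((h1 2).const_mul s).const_add 1) fun ρ hρ => hρ.1
  · exact div (h1 1) (((h1 2).const_mul s).const_add 1) fun ρ hρ => hρ.1
  · exact div (h2 0) (((h2 2).const_mul t).const_add 1) fun ρ hρ => hρ.2
  · exact div (h2 1) (((h2 2).const_mul t).const_add 1) fun ρ hρ => hρ.2

lemma differentiableOn_orbitCoord (a b s t : ℝ) :
    DifferentiableOn ℝ (orbitCoord a b s t) (orbitDomain a b s t) :=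
  differentiableOn_stereoCoord (differentiable_blochFst a) (differentiable_blochSnd b) s t

lemma orbitChart_orbitCoord {a b : ℝ} (ha : a ≠ 0) (hb : b ≠ 0) (c : ℝ) {s t : ℝ}
    (hs : s ^ 2 = 1) (ht : t ^ 2 = 1) {ρ : TwoQubitMatrix}
    (hρ : ρ ∈ blochOrbit a b c ∩ orbitDomain a b s t) :
    orbitChart a b c s t (orbitCoord a b s t ρ) = ρ := by
  obtain ⟨⟨n, hn, m, hm, rfl⟩, h1, h2⟩ := hρ
  rw [blochFst_correlatedState ha] at h1
  rw [blochSnd_correlatedState hb] at h2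
  simp only [orbitChart, orbitCoord, blochFst_correlatedState ha, blochSnd_correlatedState hb]
  exact congrArg₂ (fun n m => correlatedState a b c (bloch n) (bloch m))
    (stereo_leftInverse hs hn h1) (stereo_leftInverse ht hm h2)

lemma orbitChart_mem {a b : ℝ} (ha : a ≠ 0) (hb : b ≠ 0) (c : ℝ) {s t : ℝ} (hs : s ^ 2 = 1)
    (ht : t ^ 2 = 1) (v : Fin (2 * 2) → ℝ) :
    orbitChart a b c s t v ∈ blochOrbit a b c ∩ orbitDomain a b s t := by
  refine ⟨⟨_, stereo_mem_blochSphere hs _ _, _, stereo_mem_blochSphere ht _ _, rfl⟩, ?_, ?_⟩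
  · rw [orbitChart, blochFst_correlatedState ha, one_add_mul_stereo hs]
    positivity
  · rw [orbitChart, blochSnd_correlatedState hb, one_add_mul_stereo ht]
    positivity

lemma orbitCoord_orbitChart {a b : ℝ} (ha : a ≠ 0) (hb : b ≠ 0) (c : ℝ) {s t : ℝ}
    (hs : s ^ 2 = 1) (ht : t ^ 2 = 1) (v : Fin (2 * 2) → ℝ) :
    orbitCoord a b s t (orbitChart a b c s t v) = v := by
  have h1 : 1 + v 0 ^ 2 + v 1 ^ 2 ≠ 0 := by positivity
  have h2 : 1 + v 2 ^ 2 + v 3 ^ 2 ≠ 0 := by positivity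
  simp only [orbitChart, orbitCoord, blochFst_correlatedState ha, blochSnd_correlatedState hb,
    one_add_mul_stereo hs, one_add_mul_stereo ht]
  ext i
  fin_cases i <;> simp [stereo] <;> field_simp

lemma isLocalParametrization_orbitChart {a b : ℝ} (ha : a ≠ 0) (hb : b ≠ 0) (c : ℝ) {s t : ℝ}
    (hs : s ^ 2 = 1) (ht : t ^ 2 = 1) :
    IsLocalParametrization (blochOrbit a b c) Set.univ (orbitChart a b c s t) :=
  isLocalParametrization_of_leftInverse (isOpen_orbitDomain a b s t)
    (contDiff_orbitChart a b c s t) (differentiableOn_orbitCoord a b s t)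
    (orbitChart_mem ha hb c hs ht) (orbitCoord_orbitChart ha hb c hs ht)
    fun _ hρ => orbitChart_orbitCoord ha hb c hs ht hρ

/-! ### The Liouville measure of the orbit -/

lemma chartMeasure_inter_orbitDomain_le {a b : ℝ} (ha : a ≠ 0) (hb : b ≠ 0) (c : ℝ) {s t : ℝ}
    (hs : s ^ 2 = 1) (ht : t ^ 2 = 1) {U : Set (Fin (2 * 2) → ℝ)}
    {φ : (Fin (2 * 2) → ℝ) → TwoQubitMatrix} (hφ : IsLocalParametrization (blochOrbit a b c) U φ)
    {A : Set TwoQubitMatrix} (hA : MeasurableSet A) :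
    chartMeasure 2 kksForm U φ (A ∩ orbitDomain a b s t) ≤
      chartMeasure 2 kksForm Set.univ (orbitChart a b c s t) A := by
  refine chartMeasure_inter_le hφ (isOpen_orbitDomain a b s t)
    (differentiable_orbitChart a b c s t) (differentiableOn_orbitCoord a b s t)
    (fun _ hρ => orbitChart_orbitCoord ha hb c hs ht hρ) (fun y J => ?_) hA
  have h := pfaffian_orbitChart a b c hs ht y (ContinuousLinearMap.id ℝ _)
  rw [ContinuousLinearMap.det, ContinuousLinearMap.coe_id, LinearMap.det_id, one_mul] at h
  rw [pfaffian_orbitChart a b c hs ht, ← h]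
  rfl

/-- In any of the four charts, the points missed by the chart with both signs 1 have coordinates in
one of two hyperplanes. -/
lemma chartMeasure_orbitChart_compl {a b : ℝ} (ha : a ≠ 0) (hb : b ≠ 0) (c : ℝ) {s t : ℝ}
    (hs : s = 1 ∨ s = -1) (ht : t = 1 ∨ t = -1) :
    chartMeasure 2 kksForm Set.univ (orbitChart a b c s t) (orbitDomain a b 1 1)ᶜ = 0 := by
  have hm : MeasurableSet (orbitDomain a b 1 1)ᶜ :=
    (isOpen_orbitDomain a b 1 1).measurableSet.compl
  rw [chartMeasure_apply _ MeasurableSet.univ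
    (differentiable_orbitChart a b c s t).continuous.continuousOn hm]
  refine setLIntegral_measure_zero _ _ (measure_mono_null
    (t := {v : Fin (2 * 2) → ℝ | v 0 = 0} ∪ {v | v 2 = 0}) ?_ (measure_union_null ?_ ?_))
  · rintro v ⟨hv, -⟩
    rw [Set.mem_preimage, Set.mem_compl_iff, orbitDomain, Set.mem_ofPred_eq, not_and_or,
      not_not, not_not, orbitChart, blochFst_correlatedState ha, blochSnd_correlatedState hb,
      one_mul, one_mul] at hv
    exact hv.imp (one_add_stereo_eq_zero hs) (one_add_stereo_eq_zero ht)
  · exact Measure.pi_hyperplane _ _ _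
  · exact Measure.pi_hyperplane _ _ _

/-- On each of the four domains `φ` is dominated by the corresponding chart, which gives no mass to
`Wᶜ`. The domains cover everything, so the measure of `φ` lives on `W`, where the single chart with
signs 1, 1 dominates it. -/
lemma chartMeasure_le {a b : ℝ} (ha : a ≠ 0) (hb : b ≠ 0) (c : ℝ) {U : Set (Fin (2 * 2) → ℝ)}
    {φ : (Fin (2 * 2) → ℝ) → TwoQubitMatrix}
    (hφ : IsLocalParametrization (blochOrbit a b c) U φ) :
    chartMeasure 2 kksForm U φ ≤ chartMeasure 2 kksForm Set.univ (orbitChart a b c 1 1) := by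
  set W := orbitDomain a b 1 1
  have hW : MeasurableSet W := (isOpen_orbitDomain a b 1 1).measurableSet
  have sq : ∀ {s : ℝ}, s = 1 ∨ s = -1 → s ^ 2 = 1 := by
    rintro s (rfl | rfl) <;> norm_num
  have hpart : ∀ s t : ℝ, s = 1 ∨ s = -1 → t = 1 ∨ t = -1 →
      chartMeasure 2 kksForm U φ (Wᶜ ∩ orbitDomain a b s t) = 0 := fun s t hs ht =>
    le_antisymm ((chartMeasure_inter_orbitDomain_le ha hb c (sq hs) (sq ht) hφ hW.compl).trans
      (chartMeasure_orbitChart_compl ha hb c hs ht).le) bot_le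
  have hnull : chartMeasure 2 kksForm U φ Wᶜ = 0 := by
    refine measure_mono_null (t := ((Wᶜ ∩ orbitDomain a b 1 1) ∪ (Wᶜ ∩ orbitDomain a b 1 (-1))) ∪
      ((Wᶜ ∩ orbitDomain a b (-1) 1) ∪ (Wᶜ ∩ orbitDomain a b (-1) (-1)))) ?_
      (measure_union_null
        (measure_union_null (hpart _ _ (.inl rfl) (.inl rfl)) (hpart _ _ (.inl rfl) (.inr rfl)))
        (measure_union_null (hpart _ _ (.inr rfl) (.inl rfl)) (hpart _ _ (.inr rfl) (.inr rfl))))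
    intro ρ hρ
    -- The numbers 1 + x and 1 - x add up to 2, so they cannot both vanish; hence the four domains
    -- cover all matrices, not only the orbit.
    have key : ∀ x : ℝ, 1 + 1 * x ≠ 0 ∨ 1 + -1 * x ≠ 0 := fun x => by
      by_contra! h
      linarith [h.1, h.2]
    rcases key (blochFst a ρ 2) with h1 | h1 <;> rcases key (blochSnd b ρ 2) with h2 | h2
    · exact .inl (.inl ⟨hρ, h1, h2⟩)
    · exact .inl (.inr ⟨hρ, h1, h2⟩)
    · exact .inr (.inl ⟨hρ, h1, h2⟩)
    · exact .inr (.inr ⟨hρ, h1, h2⟩)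
  refine Measure.le_iff.2 fun A hA => ?_
  calc chartMeasure 2 kksForm U φ A
      ≤ chartMeasure 2 kksForm U φ (A ∩ W) + chartMeasure 2 kksForm U φ Wᶜ := by
        refine (measure_mono ?_).trans (measure_union_le _ _)
        intro ρ hρ
        by_cases h : ρ ∈ W
        · exact .inl ⟨hρ, h⟩
        · exact .inr h
    _ ≤ _ := by
        rw [hnull, add_zero]
        exact chartMeasure_inter_orbitDomain_le ha hb c (one_pow 2) (one_pow 2) hφ hA

lemma symplecticVolume_blochOrbit {a b : ℝ} (ha : 0 < a) (hb : 0 < b) (c : ℝ) :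
    symplecticVolume 2 (blochOrbit a b c) kksForm = ENNReal.ofReal (a * b) := by
  have h1 : (1 : ℝ) ^ 2 = 1 := one_pow 2
  have huniv := chartMeasure_orbitChart_univ ha hb c h1 h1
  refine le_antisymm ?_ ?_
  · have h : liouvilleMeasure 2 (blochOrbit a b c) kksForm ≤
        chartMeasure 2 kksForm Set.univ (orbitChart a b c 1 1) :=
      iSup_le fun U => iSup_le fun φ => iSup_le fun hφ => chartMeasure_le ha.ne' hb.ne' c hφ
    exact (h _).trans ((measure_mono (Set.subset_univ _)).trans huniv.le)
  · have h : chartMeasure 2 kksForm Set.univ (orbitChart a b c 1 1) ≤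
        liouvilleMeasure 2 (blochOrbit a b c) kksForm :=
      le_iSup_of_le Set.univ (le_iSup_of_le (orbitChart a b c 1 1) (le_iSup_of_le
        (isLocalParametrization_orbitChart ha.ne' hb.ne' c h1 h1) le_rfl))
    refine le_trans ?_ (h _)
    have hc := (differentiable_orbitChart a b c 1 1).continuous
    rw [← huniv, chartMeasure, Measure.map_apply_of_aemeasurable hc.aemeasurable MeasurableSet.univ]
    -- The lower bound for a push-forward holds on arbitrary sets, so measurability of the orbit is
    -- not needed; the chart takes all its values in the orbit.
    refine le_trans (measure_mono fun v _ => ?_) (Measure.le_map_apply hc.aemeasurable _)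
    exact (orbitChart_mem ha.ne' hb.ne' c h1 h1 v).1

end

/-- Let `l₁ > l₂ > l₃ > l₄ ≥ 0` with sum `1` and let `Λ = diag (l₁, l₂, l₃, l₄)`. The map
`ρ ↦ (X ↦ -i tr (ρ X))` into `𝔨*` is injective on the local unitary orbit of `Λ`, which it thus
identifies with a coadjoint orbit of `U(2) ⊗ U(2)`; and the symplectic volume of this
four-dimensional orbit is `(l₁ + l₂ - l₃ - l₄) (l₁ + l₃ - l₂ - l₄)`. -/
theorem mainTheorem6 (l₁ l₂ l₃ l₄ : ℝ) (h₁₂ : l₂ < l₁) (h₂₃ : l₃ < l₂) (h₃₄ : l₄ < l₃)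
    (h₄ : 0 ≤ l₄) (hsum : l₁ + l₂ + l₃ + l₄ = 1) :
    Set.InjOn coadjointPoint (localUnitaryOrbit (diagonalState l₁ l₂ l₃ l₄)) ∧
      symplecticVolume 2 (localUnitaryOrbit (diagonalState l₁ l₂ l₃ l₄)) kksForm =
        ENNReal.ofReal ((l₁ + l₂ - l₃ - l₄) * (l₁ + l₃ - l₂ - l₄)) := by

  -- The strict ordering makes both marginals nondegenerate, so neither sphere collapses to a point
  -- under the coadjoint map.
  have ha : 0 < l₁ + l₂ - l₃ - l₄ := by linarith
  have hb : 0 < l₁ + l₃ - l₂ - l₄ := by linarith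
  have h : localUnitaryOrbit (diagonalState l₁ l₂ l₃ l₄) =
      blochOrbit (l₁ + l₂ - l₃ - l₄) (l₁ + l₃ - l₂ - l₄) (l₁ + l₄ - l₂ - l₃) := by
    rw [diagonalState_eq l₁ l₂ l₃ l₄ hsum]
    exact localUnitaryOrbit_correlatedState _ _ _
  rw [h]
  exact ⟨injOn_coadjointPoint ha.ne' hb.ne' _, symplecticVolume_blochOrbit ha hb _⟩
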